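/- Let $n\ge 2$ be an integer and let $\mathscr C_n$ be the set of all $n$-cycles in the symmetric group of permutations of $\{1,\dots,n\}$. The degree (cyclic descent number) of a permutation $\nu$ of $\{1,\dots,n\}$ is $$\deg(\nu)=\#\{\,1\le i\le n:\ \nu(i)>\nu(i+1)\,\},$$ where $i$ is taken modulo $n$, so that $\nu(n+1)=\nu(1)$. For $d\ge 1$ let $N_{n,d}$ be the number of $\nu\in\mathscr C_n$ with $\deg(\nu)=d$, and for $k\ge 1$ let $$\Delta_n(k)=\sum_{r\mid n}\mu\Big(\frac nr\Big)\Big(\sum_{j=0}^{r-1}k^j\Big),$$ where $\mu$ is the Möbius function. Then for every $d\ge 1$, $$N_{n,d}=\sum_{i=1}^{d}(-1)^{d-i}\binom{n}{d-i}\Delta_n(i).$$ In particular, if $n\ge 3$, then the sum on the right-hand side vanishes for every $d\ge n-1$. -/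

import Mathlib

/-- The degree (cyclic descent number) of a permutation `ν` of `n` points: the number of `i` with
`ν i > ν (i + 1)`, where `i` is taken modulo `n` (`finRotate n` is the map `i ↦ i + 1` mod `n`). -/
def cycDeg {n : ℕ} (ν : Equiv.Perm (Fin n)) : ℕ :=
  (Finset.univ.filter fun i : Fin n => ν (finRotate n i) < ν i).card

/-- The `n`-cycles in the symmetric group on `n` points: a single cycle moving every point
(for `n ≥ 2`). -/
noncomputable def nCycles (n : ℕ) : Finset (Equiv.Perm (Fin n)) :=
  open Classical in Finset.univ.filter fun ν => ν.IsCycle ∧ ν.support = Finset.univ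

/-- `N_{n,d}`: the number of `n`-cycles of degree `d`. -/
noncomputable def numCyclesOfDeg (n d : ℕ) : ℕ :=
  ((nCycles n).filter fun ν => cycDeg ν = d).card

/-- `Δ_n(k) = ∑_{r ∣ n} μ(n / r) (1 + k + ⋯ + k ^ (r - 1))`. -/
def cycDelta (n k : ℕ) : ℤ :=
  ∑ r ∈ n.divisors, ArithmeticFunction.moebius (n / r) * ∑ j ∈ Finset.range r, (k : ℤ) ^ j

/-!
Call an increasing map `f : ℤ → ℤ` with `f (i + n) = f i + k n` inducing `ν` on `ℤ / n` a lift of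
`ν` of degree `k`. Between `i` and `i + 1` the map `f` must cross a multiple of `n` at each
descent of `ν`, so a lift is the same thing as a distribution of `k - deg ν` additional crossings
among the `n` points of the circle.

On the other hand, lifts of degree `k` of `n`-cycles are counted by `Δ_n(k)`. Put
`M = 1 + k + ⋯ + k ^ (n - 1)`. The average of `a, f a, …, f^[n - 1] a` is a strictly increasing
function of `a` which, up to normalization, conjugates `f` to an affine map `X ↦ k X + j` modulo
`M` under which `0` has exact period `n`. Conversely, such a `j` recovers `f` as the action of the
affine map on the `n` points of the orbit of `0`, in their cyclic order. Since the period
of `0` divides `n` for every `j`, these `j` are counted by Möbius inversion.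

Together, `∑ Δ_n(k) X ^ k = (∑ X ^ deg ν) / (1 - X) ^ n`, which is inverted by multiplying with
`(1 - X) ^ n`. For the vanishing, if `deg ν ≥ n - 1`, then the reversal of `ν` has degree at most
`1`, so it has a lift of degree `1` and is a rotation; then `ν` is an involution, not an `n`-cycle.
-/

open Finset Function

theorem le_iff_ediv_add_le_ediv {n : ℤ} (hn : 0 < n) (a b : ℤ) :
    a ≤ b ↔ a / n + (if b % n < a % n then 1 else 0) ≤ b / n := by
  have ha := Int.emod_nonneg a hn.ne'
  have hb := Int.emod_nonneg b hn.ne'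
  have ha' := Int.emod_lt_of_pos a hn
  have hb' := Int.emod_lt_of_pos b hn
  conv_lhs => rw [← Int.mul_ediv_add_emod a n, ← Int.mul_ediv_add_emod b n]
  rcases lt_trichotomy (a / n) (b / n) with h | h | h
  · have : n * (a / n + 1) ≤ n * (b / n) := by gcongr; omega
    split_ifs <;> constructor <;> intro <;> linarith
  · rw [h]
    split_ifs <;> constructor <;> intro <;> linarith
  · have : n * (b / n + 1) ≤ n * (a / n) := by gcongr; omega
    split_ifs <;> constructor <;> intro <;> linarith

theorem exists_map_add_one_eq_add {A : Type*} [AddCommGroup A] (w : ℤ → A) :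
    ∃ W : ℤ → A, W 0 = 0 ∧ ∀ i, W (i + 1) = W i + w i := by
  refine ⟨fun i => ∑ l ∈ Ico 0 i, w l - ∑ l ∈ Ico i 0, w l, by simp, fun i => ?_⟩
  beta_reduce
  rcases le_or_gt 0 i with hi | hi
  · have h : Ico 0 (i + 1) = insert i (Ico 0 i) := by ext; simp; omega
    rw [h, sum_insert (by simp), Ico_eq_empty_of_le hi,
      Ico_eq_empty_of_le (show 0 ≤ i + 1 by omega)]
    abel
  · have h : Ico i 0 = insert i (Ico (i + 1) 0) := by ext; simp; omega
    rw [h, sum_insert (by simp), Ico_eq_empty_of_le hi.le,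
      Ico_eq_empty_of_le (show i + 1 ≤ 0 by omega)]
    abel

theorem eq_of_forall_add_one_sub_eq {A : Type*} [AddCommGroup A] {f g : ℤ → A}
    (h : ∀ i, f (i + 1) - f i = g (i + 1) - g i) (h0 : f 0 = g 0) : f = g := by
  have hper : Periodic (f - g) 1 := fun i => by
    simpa [sub_eq_sub_iff_sub_eq_sub] using h i
  funext i
  simpa [h0, sub_eq_zero] using hper.int_mul_eq i

theorem eq_of_strictMono_of_range_eq {α : Type*} [PartialOrder α] {f g : ℤ → α}
    (hf : StrictMono f) (hg : StrictMono g) (h : Set.range f = Set.range g) (h0 : f 0 = g 0) :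
    f = g := by
  let φ : ℤ ≃o ℤ :=
    (hf.orderIso f).trans ((OrderIso.setCongr _ _ h).trans (hg.orderIso g).symm)
  have hφ (i : ℤ) : g (φ i) = f i :=
    congrArg Subtype.val ((hg.orderIso g).apply_symm_apply ⟨f i, h ▸ ⟨i, rfl⟩⟩)
  have hφ_zero : φ 0 = 0 := hg.injective ((hφ 0).trans h0)
  have hφ_succ (i : ℤ) : φ (i + 1) = φ i + 1 := φ.map_succ i
  have hφ_id : ⇑φ = id := eq_of_forall_add_one_sub_eq (by simp [hφ_succ]) hφ_zero
  funext i
  rw [← hφ i, hφ_id, id]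

theorem eq_of_monotone_of_periodic {α β : Type*} [AddCommGroup α] [LinearOrder α]
    [IsOrderedAddMonoid α] [Archimedean α] [PartialOrder β] {f : α → β} {c : α}
    (hf : Monotone f) (hper : Periodic f c) (hc : 0 < c) (x y : α) : f x = f y := by
  have hle (x y : α) : f x ≤ f y := by
    obtain ⟨m, hm⟩ := Archimedean.arch (x - y) hc
    rw [← hper.nsmul m y]
    exact hf (by rwa [sub_le_iff_le_add'] at hm)
  exact (hle x y).antisymm (hle y x)

theorem val_fin_add_mul_ediv {n : ℕ} (x : Fin n) (q : ℤ) : ((x : ℕ) + n * q : ℤ) / n = q := by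
  rw [Int.add_mul_ediv_left _ _ (by have := x.pos; omega),
    Int.ediv_eq_zero_of_lt (Int.natCast_nonneg _) (Int.ofNat_lt.2 x.2), zero_add]

section Residues

open scoped Fin.CommRing

variable {n : ℕ} [NeZero n]

theorem intCast_fin_eq_iff {i j : ℤ} : (i : Fin n) = j ↔ ∃ q, i = j + n * q := by
  rw [eq_comm, CharP.intCast_eq_intCast (Fin n) n, Int.modEq_iff_add_fac]

theorem coe_val_intCast_fin (i : ℤ) : (((i : Fin n) : ℕ) : ℤ) = i % n := by
  rw [Fin.val_intCast, Int.toNat_of_nonneg (Int.emod_nonneg i (NeZero.ne _))]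

theorem intCast_val_fin (x : Fin n) : (((x : ℕ) : ℤ) : Fin n) = x := by
  rw [Int.cast_natCast, Fin.cast_val_eq_self]

theorem intCast_val_fin_add_mul (x : Fin n) (q : ℤ) : (((x : ℕ) + n * q : ℤ) : Fin n) = x := by
  rw [intCast_fin_eq_iff.2 ⟨q, rfl⟩, intCast_val_fin]

theorem apply_val_intCast_fin_of_periodic {α : Type*} {w : ℤ → α} (hw : Periodic w n) (i : ℤ) :
    w ((i : Fin n) : ℕ) = w i := by
  rw [coe_val_intCast_fin, Int.emod_def, mul_comm]
  exact hw.sub_int_mul_eq (i / n)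

theorem map_add_eq_add_sum_of_map_add_one {A : Type*} [AddCommGroup A] {W : ℤ → A} {w : Fin n → A}
    (hW : ∀ i : ℤ, W (i + 1) = W i + w i) (i : ℤ) : W (i + n) = W i + ∑ x, w x := by
  have htelescope := sum_range_sub (fun l : ℕ => W (i + l)) n
  simp only [Nat.cast_add_one, ← add_assoc, hW, add_sub_cancel_left, Nat.cast_zero, add_zero]
    at htelescope
  rw [← sub_eq_iff_eq_add', ← htelescope, ← Fin.sum_univ_eq_sum_range fun l => w (i + l : ℤ),
    ← Equiv.sum_comp (Equiv.addLeft (i : Fin n)) w]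
  simp

end Residues

section Lifts

open scoped Fin.CommRing

/-- `f : ℤ → ℤ` is a lift of degree `k` of the permutation `ν` of `Fin n = ℤ / n`, normalized by
`0 ≤ f 0 < n`: an increasing map with `f (i + n) = f i + k * n` inducing `ν` modulo `n`. -/
structure IsLift (n k : ℕ) [NeZero n] (ν : Equiv.Perm (Fin n)) (f : ℤ → ℤ) : Prop where
  strictMono : StrictMono f
  map_add : ∀ i, f (i + n) = f i + k * n
  map_zero_mem : f 0 ∈ Set.Ico (0 : ℤ) n
  cast_map : ∀ i, (f i : Fin n) = ν i

/-- The indicator of the cyclic descents of `ν`, the set counted by `cycDeg ν`. -/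
def cycDescent {n : ℕ} (ν : Equiv.Perm (Fin n)) (x : Fin n) : ℕ :=
  if ν (finRotate n x) < ν x then 1 else 0

/-- The number of multiples of `n` in the interval `(f i, f (i + 1)]`. -/
def turns (n : ℕ) (f : ℤ → ℤ) (i : ℤ) : ℤ := f (i + 1) / n - f i / n

/-- The part of `turns n f` not forced by the descents of `ν`: if `f` is a lift of `ν`, then
`turns n f` is at least `cycDescent ν`, so that the truncation is harmless. -/
def excess {n : ℕ} (ν : Equiv.Perm (Fin n)) (f : ℤ → ℤ) (x : Fin n) : ℕ :=
  (turns n f (x : ℕ) - cycDescent ν x).toNat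

theorem cycDeg_eq_sum {n : ℕ} (ν : Equiv.Perm (Fin n)) : cycDeg ν = ∑ x, cycDescent ν x :=
  card_filter _ _

variable {n k : ℕ} [NeZero n] {ν : Equiv.Perm (Fin n)} {f : ℤ → ℤ}

theorem le_add_one_iff_cycDescent_le_turns (hf : ∀ i : ℤ, (f i : Fin n) = ν i) (i : ℤ) :
    f i ≤ f (i + 1) ↔ cycDescent ν i ≤ turns n f i := by
  have hdescent : (cycDescent ν i : ℤ) = if f (i + 1) % n < f i % n then 1 else 0 := by
    have hsucc : finRotate n i = ((i + 1 : ℤ) : Fin n) := by rw [finRotate_apply]; push_cast; rfl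
    simp only [cycDescent, hsucc, ← hf, Fin.lt_def, ← coe_val_intCast_fin, Nat.cast_lt]
    push_cast
    rfl
  rw [hdescent, turns, le_sub_iff_add_le']
  exact le_iff_ediv_add_le_ediv (Int.natCast_pos.2 (NeZero.pos n)) _ _

theorem strictMono_iff_cycDescent_le_turns [Nontrivial (Fin n)]
    (hf : ∀ i : ℤ, (f i : Fin n) = ν i) :
    StrictMono f ↔ ∀ i : ℤ, cycDescent ν i ≤ turns n f i := by
  simp only [← le_add_one_iff_cycDescent_le_turns hf]
  refine ⟨fun h i => h.monotone (by omega), fun h => strictMono_int_of_lt_succ fun i => ?_⟩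
  refine (h i).lt_of_ne fun heq => ?_
  have hcast : ν i = ν (i + 1 : ℤ) := by rw [← hf, ← hf, heq]
  simpa using ν.injective hcast

namespace IsLift

theorem periodic_turns (hf : IsLift n k ν f) : Periodic (turns n f) n := fun i => by
  rw [turns, add_right_comm, hf.map_add, hf.map_add, Int.add_mul_ediv_right _ _ (NeZero.ne _),
    Int.add_mul_ediv_right _ _ (NeZero.ne _), add_sub_add_right_eq_sub, turns]

theorem sum_turns (hf : IsLift n k ν f) : ∑ x : Fin n, turns n f (x : ℕ) = k := by
  have hadd := map_add_eq_add_sum_of_map_add_one (W := fun i => f i / (n : ℤ))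
    (w := fun x : Fin n => turns n f (x : ℕ)) (fun i => by
      rw [apply_val_intCast_fin_of_periodic hf.periodic_turns, turns, add_sub_cancel]) 0
  rw [zero_add, ← zero_add (n : ℤ), hf.map_add, zero_add,
    Int.add_mul_ediv_right _ _ (NeZero.ne _)] at hadd
  exact (add_left_cancel hadd).symm

variable [Nontrivial (Fin n)]

theorem coe_excess (hf : IsLift n k ν f) (x : Fin n) :
    (excess ν f x : ℤ) = turns n f (x : ℕ) - cycDescent ν x := by
  have h := (strictMono_iff_cycDescent_le_turns hf.cast_map).1 hf.strictMono (x : ℕ)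
  rw [intCast_val_fin] at h
  rw [excess, Int.toNat_sub_of_le h]

theorem sum_excess (hf : IsLift n k ν f) : ∑ x, excess ν f x + cycDeg ν = k := by
  have h : (∑ x, (excess ν f x : ℤ)) + cycDeg ν = k := by
    rw [sum_congr rfl fun x _ => hf.coe_excess x, sum_sub_distrib, hf.sum_turns, cycDeg_eq_sum]
    push_cast
    ring
  exact_mod_cast h

theorem eq_of_excess_eq {g : ℤ → ℤ} (hf : IsLift n k ν f) (hg : IsLift n k ν g)
    (h : excess ν f = excess ν g) : f = g := by
  have hturns (i : ℤ) : turns n f i = turns n g i := by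
    rw [← apply_val_intCast_fin_of_periodic hf.periodic_turns,
      ← apply_val_intCast_fin_of_periodic hg.periodic_turns]
    linarith [hf.coe_excess i, hg.coe_excess i, congrFun h i]
  have hdiv : (fun i => f i / (n : ℤ)) = fun i => g i / (n : ℤ) :=
    eq_of_forall_add_one_sub_eq hturns <| by
      rw [Int.ediv_eq_zero_of_lt hf.map_zero_mem.1 hf.map_zero_mem.2,
        Int.ediv_eq_zero_of_lt hg.map_zero_mem.1 hg.map_zero_mem.2]
  funext i
  rw [← Int.mul_ediv_add_emod (f i) n, ← Int.mul_ediv_add_emod (g i) n, congrFun hdiv i,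
    ← coe_val_intCast_fin (f i), ← coe_val_intCast_fin (g i), hf.cast_map, hg.cast_map]

end IsLift

theorem exists_isLift_of_sum_add_cycDeg_eq [Nontrivial (Fin n)] (ν : Equiv.Perm (Fin n))
    (a : Fin n → ℕ) (ha : ∑ x, a x + cycDeg ν = k) : ∃ f, IsLift n k ν f ∧ excess ν f = a := by
  obtain ⟨W, hW0, hW⟩ := exists_map_add_one_eq_add
    (fun i : ℤ => (a i : ℤ) + cycDescent ν i)
  have hWadd (i : ℤ) : W (i + n) = W i + k := by
    rw [map_add_eq_add_sum_of_map_add_one (w := fun x => (a x : ℤ) + cycDescent ν x) hW i, ← ha,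
      cycDeg_eq_sum, ← sum_add_distrib]
    push_cast
    rfl
  let f (i : ℤ) : ℤ := ν i + n * W i
  have hdiv (i : ℤ) : f i / n = W i := val_fin_add_mul_ediv _ _
  have hturns (i : ℤ) : turns n f i = a i + cycDescent ν i := by
    rw [turns, hdiv, hdiv, hW, add_sub_cancel_left]
  have hcast (i : ℤ) : (f i : Fin n) = ν i := intCast_val_fin_add_mul _ _
  refine ⟨f, ⟨?_, fun i => ?_, ?_, hcast⟩, ?_⟩
  · rw [strictMono_iff_cycDescent_le_turns hcast]
    simp [hturns]
  · have hperiod : ((i + n : ℤ) : Fin n) = i := by simp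
    simp only [f, hWadd, hperiod]
    ring
  · simp [f, hW0]
  · funext x
    rw [excess, hturns, intCast_val_fin]
    omega

/-- A lift of `ν` is determined by its excess, which is an arbitrary function with the right sum. -/
noncomputable def liftEquivExcess [Nontrivial (Fin n)] (k : ℕ) (ν : Equiv.Perm (Fin n)) :
    {f // IsLift n k ν f} ≃ {a : Fin n → ℕ // ∑ x, a x + cycDeg ν = k} :=
  Equiv.ofBijective (fun f => ⟨excess ν f, f.2.sum_excess⟩)
    ⟨fun f g h => Subtype.ext (f.2.eq_of_excess_eq g.2 (congrArg Subtype.val h)), fun a =>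
      let ⟨f, hf, h⟩ := exists_isLift_of_sum_add_cycDeg_eq ν a.1 a.2
      ⟨⟨f, hf⟩, Subtype.ext h⟩⟩

end Lifts

section AffineMaps

/-- The geometric sum `1 + k + ⋯ + k ^ (m - 1)`, the modulus in which lifts of degree `k` become
affine. -/
def geomSum (k m : ℕ) : ℕ := ∑ i ∈ range m, k ^ i

theorem geomSum_zero (k : ℕ) : geomSum k 0 = 0 := sum_range_zero _

theorem geomSum_succ (k m : ℕ) : geomSum k (m + 1) = k * geomSum k m + 1 := geom_sum_succ

theorem geomSum_pos (k : ℕ) {m : ℕ} (hm : 0 < m) : 0 < geomSum k m := by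
  obtain ⟨m, rfl⟩ := Nat.exists_eq_succ_of_ne_zero hm.ne'
  exact geomSum_succ k m ▸ Nat.succ_pos _

theorem geomSum_add (k r m : ℕ) : geomSum k (r + m) = geomSum k r + k ^ r * geomSum k m := by
  simp only [geomSum, sum_range_add, pow_add, mul_sum]

theorem geomSum_mul (k r c : ℕ) : geomSum k (r * c) = geomSum k r * geomSum (k ^ r) c := by
  induction c with
  | zero => simp [geomSum_zero]
  | succ c ih =>
    have hsucc : geomSum (k ^ r) (c + 1) = geomSum (k ^ r) c + k ^ (r * c) := by
      rw [pow_mul]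
      exact sum_range_succ _ _
    rw [Nat.mul_succ, geomSum_add, ih, hsucc]
    ring

/-- The affine map `X ↦ k X + j` modulo `M`. -/
def affineMod (k M : ℕ) (j : ℤ) (X : ZMod M) : ZMod M := k * X + j

variable {k M m r n : ℕ} {j : ℤ}

theorem affineMod_iterate_zero : (affineMod k M j)^[m] 0 = (geomSum k m * j : ℤ) := by
  induction m with
  | zero => simp [geomSum_zero]
  | succ m ih =>
    rw [iterate_succ_apply', ih, affineMod, geomSum_succ]
    push_cast
    ring

theorem isPeriodicPt_affineMod_iff :
    IsPeriodicPt (affineMod k M j) m 0 ↔ (M : ℤ) ∣ geomSum k m * j := by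
  rw [IsPeriodicPt, IsFixedPt, affineMod_iterate_zero, ZMod.intCast_zmod_eq_zero_iff_dvd]

theorem minimalPeriod_affineMod_mul {c : ℕ} (hc : 0 < c) :
    minimalPeriod (affineMod k (M * c) (j * c)) 0 = minimalPeriod (affineMod k M j) 0 := by
  rw [minimalPeriod_eq_minimalPeriod_iff]
  intro m
  rw [isPeriodicPt_affineMod_iff, isPeriodicPt_affineMod_iff, Nat.cast_mul, ← mul_assoc,
    Int.mul_dvd_mul_iff_right (by positivity)]

/-- The integers `j` with `0 ≤ j < geomSum k n` such that `0` has exact period `n` under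
`X ↦ k X + j` modulo `geomSum k n`. -/
noncomputable def primitiveOffsets (k n : ℕ) : Finset ℤ :=
  {j ∈ Ico (0 : ℤ) (geomSum k n) | minimalPeriod (affineMod k (geomSum k n) j) 0 = n}

theorem card_filter_minimalPeriod_affineMod_eq (hn : 0 < n) (hr : r ∣ n) :
    #{j ∈ Ico (0 : ℤ) (geomSum k n) | minimalPeriod (affineMod k (geomSum k n) j) 0 = r} =
      #(primitiveOffsets k r) := by
  obtain ⟨c, rfl⟩ := hr
  have hr : 0 < geomSum k r := geomSum_pos k (Nat.pos_of_mul_pos_right hn)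
  have hc : 0 < geomSum (k ^ r) c := geomSum_pos _ (Nat.pos_of_mul_pos_left hn)
  rw [geomSum_mul]
  generalize geomSum (k ^ r) c = d at hc
  have hmem (j : ℤ) : j ∈ primitiveOffsets k r ↔ j * d ∈ Ico (0 : ℤ) (geomSum k r * d : ℕ) ∧
      minimalPeriod (affineMod k (geomSum k r * d) (j * d)) 0 = r := by
    rw [primitiveOffsets, mem_filter, minimalPeriod_affineMod_mul hc, mem_Ico, mem_Ico,
      Nat.cast_mul, mul_lt_mul_iff_of_pos_right (by positivity),
      mul_nonneg_iff_of_pos_right (by positivity)]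
  symm
  refine card_bij (fun j _ => j * d) (fun j hj => mem_filter.2 ((hmem j).1 hj))
    (fun i _ j _ hij => Int.eq_of_mul_eq_mul_right (by positivity) hij) fun j hj => ?_
  rw [mem_filter] at hj
  have hper := isPeriodicPt_minimalPeriod (affineMod k (geomSum k r * d) j) 0
  rw [hj.2, isPeriodicPt_affineMod_iff, Nat.cast_mul,
    Int.mul_dvd_mul_iff_left (by positivity)] at hper
  obtain ⟨i, rfl⟩ := hper
  rw [mul_comm (d : ℤ)] at hj
  exact ⟨i, (hmem i).2 hj, mul_comm _ _⟩

theorem sum_card_primitiveOffsets (k : ℕ) (hn : 0 < n) :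
    ∑ r ∈ n.divisors, #(primitiveOffsets k r) = geomSum k n := by
  have hmaps (j : ℤ) : minimalPeriod (affineMod k (geomSum k n) j) 0 ∈ n.divisors := by
    rw [Nat.mem_divisors, ← isPeriodicPt_iff_minimalPeriod_dvd, isPeriodicPt_affineMod_iff]
    exact ⟨dvd_mul_right _ _, hn.ne'⟩
  calc ∑ r ∈ n.divisors, #(primitiveOffsets k r)
      = ∑ r ∈ n.divisors, #{j ∈ Ico (0 : ℤ) (geomSum k n) |
          minimalPeriod (affineMod k (geomSum k n) j) 0 = r} :=
        sum_congr rfl fun r hr =>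
          (card_filter_minimalPeriod_affineMod_eq hn (Nat.dvd_of_mem_divisors hr)).symm
    _ = #(Ico (0 : ℤ) (geomSum k n)) := (card_eq_sum_card_fiberwise fun j _ => hmaps j).symm
    _ = geomSum k n := by simp

theorem cycDelta_eq_card_primitiveOffsets (k : ℕ) (hn : 0 < n) :
    cycDelta n k = #(primitiveOffsets k n) := by
  have hmoebius := (ArithmeticFunction.sum_eq_iff_sum_mul_moebius_eq (R := ℤ)
    (f := fun n => #(primitiveOffsets k n)) (g := fun n => geomSum k n)).1
    (fun n hn => mod_cast sum_card_primitiveOffsets k hn) n hn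
  rw [← hmoebius, ← Nat.map_div_left_divisors, sum_map]
  simp only [cycDelta, geomSum, Nat.cast_sum, Nat.cast_pow, Int.cast_id]
  rfl

theorem pos_of_mem_primitiveOffsets (hn : 2 ≤ n) (hj : j ∈ primitiveOffsets k n) : 0 < k := by
  rw [Nat.pos_iff_ne_zero]
  rintro rfl
  obtain ⟨m, rfl⟩ := Nat.exists_eq_add_of_le' hn
  have hM : geomSum 0 (m + 2) = 1 := by rw [geomSum_succ, zero_mul]
  have hper := (mem_filter.1 hj).2
  rw [hM, minimalPeriod_eq_one_of_subsingleton] at hper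
  omega

end AffineMaps

section Cycles

theorem mem_nCycles_iff_isCycleOn {n : ℕ} [Nontrivial (Fin n)] {ν : Equiv.Perm (Fin n)} :
    ν ∈ nCycles n ↔ ν.IsCycleOn Set.univ := by
  simp only [nCycles, mem_filter_univ]
  constructor
  · rintro ⟨hcycle, hsupport⟩
    have hmoved : {x | ν x ≠ x} = Set.univ := by
      rw [← Equiv.Perm.coe_support_eq_set_support, hsupport, coe_univ]
    exact hmoved ▸ hcycle.isCycleOn
  · refine fun h => ⟨Equiv.Perm.isCycle_iff_exists_isCycleOn.2
      ⟨Set.univ, Set.nontrivial_univ, h, fun _ _ => Set.mem_univ _⟩, ?_⟩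
    ext x
    simpa using h.apply_ne Set.nontrivial_univ (Set.mem_univ x)

theorem exists_perm_isCycleOn_univ {α : Type*} {g : α → α} {x : α} (hx : x ∈ periodicPts g)
    (h : ∀ y, ∃ m, g^[m] x = y) : ∃ ν : Equiv.Perm α, ⇑ν = g ∧ ν.IsCycleOn Set.univ := by
  have hper : periodicPts g = Set.univ := Set.eq_univ_of_forall fun y => by
    obtain ⟨m, rfl⟩ := h y
    exact (bijOn_periodicPts g).mapsTo.iterate m hx
  have hbij : Bijective g := Set.bijOn_univ.1 (hper ▸ bijOn_periodicPts g)
  refine ⟨Equiv.ofBijective g hbij, rfl, Set.bijOn_univ.2 hbij, fun y _ z _ => ?_⟩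
  have hsame (y : α) : Equiv.Perm.SameCycle (Equiv.ofBijective g hbij) x y := by
    obtain ⟨m, rfl⟩ := h y
    exact ⟨m, by rw [zpow_natCast, ← Equiv.Perm.iterate_eq_pow]; rfl⟩
  exact (hsame y).symm.trans (hsame z)

end Cycles

section Linearization

open scoped Fin.CommRing

/-- The subset of `ℤ` whose reduction modulo `M` is the orbit of `0` under `X ↦ k X + j`. -/
def affineOrbit (k M : ℕ) (j : ℤ) : Set ℤ := {X | ∃ m, (affineMod k M j)^[m] 0 = X}

theorem mem_affineOrbit_iff {k M : ℕ} {j X : ℤ} :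
    X ∈ affineOrbit k M j ↔ ∃ (m : ℕ) (q : ℤ), X = geomSum k m * j + M * q := by
  simp only [affineOrbit, Set.mem_ofPred_eq, affineMod_iterate_zero]
  refine exists_congr fun m => ?_
  rw [ZMod.intCast_eq_intCast_iff, Int.modEq_iff_add_fac]

/-- `e` is a change of coordinate, of degree one from `ℤ / n` to `ℤ / (1 + k + ⋯ + k ^ (n - 1))`,
under which the map `f` becomes affine with slope `k` and offset `j`. -/
structure IsLinearization (n k : ℕ) (j : ℤ) (f e : ℤ → ℤ) : Prop where
  strictMono : StrictMono e
  map_zero : e 0 = 0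
  map_add : ∀ i, e (i + n) = e i + geomSum k n
  map_apply : ∀ i, e (f i) = k * e i + j

variable {n k : ℕ}

theorem map_add_mul_of_map_add {a b : ℤ} {f : ℤ → ℤ} (h : ∀ i, f (i + a) = f i + b) (i q : ℤ) :
    f (i + a * q) = f i + b * q := by
  simpa [mul_comm] using AddConstMapClass.map_add_zsmul (⟨f, h⟩ : AddConstMap ℤ ℤ a b) i q

namespace IsLinearization

variable {j : ℤ} {f e : ℤ → ℤ}

theorem map_iterate_zero_add_mul (he : IsLinearization n k j f e) (m : ℕ) (q : ℤ) :
    e (f^[m] 0 + n * q) = geomSum k m * j + geomSum k n * q := by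
  rw [map_add_mul_of_map_add he.map_add]
  congr 1
  induction m with
  | zero => simp [he.map_zero, geomSum_zero]
  | succ m ih =>
    rw [iterate_succ_apply', he.map_apply, ih, geomSum_succ]
    push_cast
    ring

theorem iterate_zero_eq_mul_iff (he : IsLinearization n k j f e) {m : ℕ} {q : ℤ} :
    f^[m] 0 = n * q ↔ geomSum k m * j = geomSum k n * q := by
  have hm := he.map_iterate_zero_add_mul m 0
  have hq := he.map_iterate_zero_add_mul 0 q
  rw [mul_zero, mul_zero, add_zero, add_zero] at hm
  rw [iterate_zero, id, zero_add, geomSum_zero, Nat.cast_zero, zero_mul, zero_add] at hq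
  rw [← hm, ← hq, he.strictMono.injective.eq_iff]

theorem offset_mem_Ico_iff (he : IsLinearization n k j f e) :
    j ∈ Set.Ico (0 : ℤ) (geomSum k n) ↔ f 0 ∈ Set.Ico (0 : ℤ) n := by
  have hn : e n = geomSum k n := by simpa [he.map_zero] using he.map_add 0
  have hj : e (f 0) = j := by simpa [he.map_zero] using he.map_apply 0
  rw [← hn, ← hj, Set.mem_Ico, Set.mem_Ico, he.strictMono.lt_iff_lt]
  nth_rw 1 [← he.map_zero, he.strictMono.le_iff_le]

end IsLinearization

variable [NeZero n] {ν : Equiv.Perm (Fin n)} {f : ℤ → ℤ}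

namespace IsLift

theorem cast_iterate (hf : IsLift n k ν f) (m : ℕ) (i : ℤ) : (f^[m] i : Fin n) = (ν ^ m) i := by
  induction m with
  | zero => rfl
  | succ m ih => rw [iterate_succ_apply', hf.cast_map, ih, pow_succ', Equiv.Perm.mul_apply]

theorem iterate_add_mul (hf : IsLift n k ν f) (m : ℕ) (i q : ℤ) :
    f^[m] (i + n * q) = f^[m] i + n * (k ^ m * q) := by
  induction m with
  | zero => simp
  | succ m ih =>
    rw [iterate_succ_apply', iterate_succ_apply', ih, map_add_mul_of_map_add hf.map_add]
    ring

theorem exists_iterate_zero_eq_mul_iff (hf : IsLift n k ν f) (hν : ν.IsCycleOn Set.univ) (m : ℕ) :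
    (∃ q, f^[m] 0 = n * q) ↔ n ∣ m := by
  rw [← coe_univ] at hν
  have hdvd := hν.pow_apply_eq (mem_univ 0) (n := m)
  rw [card_univ, Fintype.card_fin] at hdvd
  have hcast := hf.cast_iterate m 0
  rw [Int.cast_zero] at hcast
  rw [← hdvd, ← hcast]
  simpa using (intCast_fin_eq_iff (i := f^[m] 0) (j := 0)).symm

theorem exists_eq_iterate_zero_add_mul (hf : IsLift n k ν f) (hν : ν.IsCycleOn Set.univ) (a : ℤ) :
    ∃ (m : ℕ) (q : ℤ), a = f^[m] 0 + n * q := by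
  rw [← coe_univ] at hν
  obtain ⟨m, -, hm⟩ := hν.exists_pow_eq (mem_univ 0) (mem_univ (a : Fin n))
  rw [← Int.cast_zero, ← hf.cast_iterate, eq_comm, intCast_fin_eq_iff] at hm
  exact ⟨m, hm⟩

theorem range_eq_affineOrbit {j : ℤ} {e : ℤ → ℤ} (hf : IsLift n k ν f) (hν : ν.IsCycleOn Set.univ)
    (he : IsLinearization n k j f e) : Set.range e = affineOrbit k (geomSum k n) j := by
  ext X
  simp only [Set.mem_range, mem_affineOrbit_iff, ← he.map_iterate_zero_add_mul]
  constructor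
  · rintro ⟨i, rfl⟩
    obtain ⟨m, q, rfl⟩ := hf.exists_eq_iterate_zero_add_mul hν i
    exact ⟨m, q, rfl⟩
  · rintro ⟨m, q, rfl⟩
    exact ⟨_, rfl⟩

theorem minimalPeriod_affineMod_eq {j : ℤ} {e : ℤ → ℤ} (hf : IsLift n k ν f)
    (hν : ν.IsCycleOn Set.univ) (he : IsLinearization n k j f e) :
    minimalPeriod (affineMod k (geomSum k n) j) 0 = n := by
  refine Nat.dvd_right_iff_eq.1 fun m => ?_
  rw [← isPeriodicPt_iff_minimalPeriod_dvd, isPeriodicPt_affineMod_iff,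
    ← hf.exists_iterate_zero_eq_mul_iff hν]
  exact exists_congr fun q => he.iterate_zero_eq_mul_iff.symm

theorem offset_mem_primitiveOffsets {j : ℤ} {e : ℤ → ℤ} (hf : IsLift n k ν f)
    (hν : ν.IsCycleOn Set.univ) (he : IsLinearization n k j f e) : j ∈ primitiveOffsets k n :=
  mem_filter.2 ⟨mem_Ico.2 (he.offset_mem_Ico_iff.2 hf.map_zero_mem),
    hf.minimalPeriod_affineMod_eq hν he⟩

theorem eq_of_isLinearization {ν' : Equiv.Perm (Fin n)} {f' e e' : ℤ → ℤ} {j : ℤ}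
    (hf : IsLift n k ν f) (hν : ν.IsCycleOn Set.univ) (he : IsLinearization n k j f e)
    (hf' : IsLift n k ν' f') (hν' : ν'.IsCycleOn Set.univ) (he' : IsLinearization n k j f' e') :
    ν = ν' ∧ f = f' := by
  have hee' : e = e' := eq_of_strictMono_of_range_eq he.strictMono he'.strictMono
    (by rw [hf.range_eq_affineOrbit hν he, hf'.range_eq_affineOrbit hν' he'])
    (he.map_zero.trans he'.map_zero.symm)
  have hff' : f = f' := funext fun i => he.strictMono.injective <| by
    rw [he.map_apply, hee', he'.map_apply]
  refine ⟨Equiv.ext fun x => ?_, hff'⟩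
  rw [← intCast_val_fin x, ← hf.cast_map, ← hf'.cast_map, hff']

theorem birkhoffSum_id_iterate_zero_add_mul (hf : IsLift n k ν f) {j : ℤ} (hj : f^[n] 0 = n * j)
    (m : ℕ) (q : ℤ) : birkhoffSum f id n (f^[m] 0 + n * q) =
      birkhoffSum f id n 0 + n * (geomSum k m * j + geomSum k n * q) := by
  have hadd (i : ℤ) : birkhoffSum f id n (i + n * q) =
      birkhoffSum f id n i + n * (geomSum k n * q) := by
    simp only [birkhoffSum, id, hf.iterate_add_mul, sum_add_distrib, ← mul_sum, ← sum_mul, geomSum]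
    push_cast
    rfl
  have hiterate : birkhoffSum f id n (f^[m] 0) =
      birkhoffSum f id n 0 + n * (geomSum k m * j) := by
    induction m with
    | zero => simp [geomSum_zero]
    | succ m ih =>
      have hstep := birkhoffSum_apply_sub_birkhoffSum f id n (f^[m] 0)
      have hcomm : f^[n] (f^[m] 0) = f^[m] 0 + n * (k ^ m * j) := by
        rw [← iterate_add_apply, add_comm, iterate_add_apply, hj, ← hf.iterate_add_mul, zero_add]
      rw [id, id, hcomm, ih, ← iterate_succ_apply' f] at hstep
      rw [geomSum_add, geomSum_succ, geomSum_zero]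
      push_cast
      linarith
  rw [hadd, hiterate]
  ring

theorem strictMono_birkhoffSum_id (hf : IsLift n k ν f) : StrictMono (birkhoffSum f id n) :=
  fun _ _ hab => sum_lt_sum_of_nonempty (nonempty_range_iff.2 (NeZero.ne n)) fun m _ =>
    hf.strictMono.iterate m hab

theorem exists_isLinearization (hf : IsLift n k ν f) (hν : ν.IsCycleOn Set.univ) :
    ∃ j e, IsLinearization n k j f e := by
  obtain ⟨j, hj⟩ := (hf.exists_iterate_zero_eq_mul_iff hν n).2 dvd_rfl
  have hS := hf.birkhoffSum_id_iterate_zero_add_mul hj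
  let e (a : ℤ) : ℤ := (birkhoffSum f id n a - birkhoffSum f id n 0) / n
  have he (m : ℕ) (q : ℤ) : e (f^[m] 0 + n * q) = geomSum k m * j + geomSum k n * q := by
    simp only [e, hS, add_sub_cancel_left]
    exact Int.mul_ediv_cancel_left _ (NeZero.ne _)
  have hmul (a : ℤ) : n * e a = birkhoffSum f id n a - birkhoffSum f id n 0 := by
    obtain ⟨m, q, rfl⟩ := hf.exists_eq_iterate_zero_add_mul hν a
    rw [he, hS]
    ring
  refine ⟨j, e, fun a b hab => ?_, by simp [e], fun i => ?_, fun i => ?_⟩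
  · have hlt := sub_lt_sub_right (hf.strictMono_birkhoffSum_id hab) (birkhoffSum f id n 0)
    rw [← hmul, ← hmul] at hlt
    exact lt_of_mul_lt_mul_left hlt (Int.natCast_nonneg n)
  · obtain ⟨m, q, rfl⟩ := hf.exists_eq_iterate_zero_add_mul hν i
    rw [show f^[m] 0 + n * q + n = f^[m] 0 + n * (q + 1) by ring, he, he]
    ring
  · obtain ⟨m, q, rfl⟩ := hf.exists_eq_iterate_zero_add_mul hν i
    rw [map_add_mul_of_map_add hf.map_add, mul_right_comm, mul_comm (k * q),
      ← iterate_succ_apply' f, he, he, geomSum_succ]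
    push_cast
    ring

end IsLift

end Linearization

section Existence

open scoped Fin.CommRing

theorem strictMono_add_mul_ediv {n M : ℕ} [NeZero n] {o : Fin n → ℕ} (ho : StrictMono o)
    (hM : ∀ x, o x < M) : StrictMono fun i : ℤ => (o i + M * (i / n) : ℤ) := by
  intro i j hij
  have hn : (0 : ℤ) < n := mod_cast NeZero.pos n
  rcases (Int.ediv_le_ediv hn hij.le).eq_or_lt with hdiv | hdiv
  · have hmod : (i : Fin n) < j := by
      rw [Fin.lt_def, ← Int.ofNat_lt, coe_val_intCast_fin, coe_val_intCast_fin, Int.emod_def,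
        Int.emod_def, hdiv]
      omega
    have := ho hmod
    dsimp only
    rw [hdiv]
    omega
  · calc (o i + M * (i / n) : ℤ) < M + M * (i / n) := by gcongr; exact hM i
      _ = M * (i / n + 1) := by ring
      _ ≤ M * (j / n) := by gcongr; omega
      _ ≤ o j + M * (j / n) := by omega

theorem exists_strictMono_range_eq_preimage {M : ℕ} [NeZero M] {O : Finset (ZMod M)} (h0 : 0 ∈ O) :
    ∃ e : ℤ → ℤ, StrictMono e ∧ e 0 = 0 ∧ (∀ i, e (i + #O) = e i + M) ∧
      ∀ X : ℤ, X ∈ Set.range e ↔ (X : ZMod M) ∈ O := by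
  have : NeZero #O := ⟨card_ne_zero_of_mem h0⟩
  let o := (O.map ⟨ZMod.val, ZMod.val_injective M⟩).orderEmbOfFin (card_map _)
  have ho (v : ℕ) : (∃ x, o x = v) ↔ ∃ z ∈ O, z.val = v := by
    rw [← Set.mem_range, range_orderEmbOfFin]
    simp
  have ho_zero : o 0 = 0 := by
    obtain ⟨x, hx⟩ := (ho 0).2 ⟨0, h0, ZMod.val_zero⟩
    exact Nat.le_zero.1 (hx ▸ o.monotone (Fin.zero_le x))
  have ho_lt (x : Fin #O) : o x < M := by
    obtain ⟨z, -, hz⟩ := (ho (o x)).1 ⟨x, rfl⟩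
    exact hz ▸ z.val_lt
  refine ⟨fun i => o i + M * (i / #O), strictMono_add_mul_ediv o.strictMono ho_lt,
    by simp [ho_zero], fun i => ?_, fun X => ⟨?_, fun hX => ?_⟩⟩
  · have hdiv : (i + #O) / #O = i / #O + 1 := by
      simpa using Int.add_mul_ediv_right i 1 (NeZero.ne (#O : ℤ))
    have hperiod : ((i + #O : ℤ) : Fin #O) = i := by simp
    simp only [hdiv, hperiod]
    ring
  · rintro ⟨i, rfl⟩
    obtain ⟨z, hz, hzi⟩ := (ho (o i)).1 ⟨i, rfl⟩
    simpa [← hzi] using hz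
  · obtain ⟨x, hx⟩ := (ho _).2 ⟨X, hX, rfl⟩
    refine ⟨(x : ℕ) + #O * (X / M), ?_⟩
    dsimp only
    rw [intCast_val_fin_add_mul, val_fin_add_mul_ediv, hx, ZMod.val_intCast,
      Int.emod_add_mul_ediv]

variable {n k : ℕ} [NeZero n] {j : ℤ}

theorem exists_isLinearization_of_minimalPeriod_eq
    (hper : minimalPeriod (affineMod k (geomSum k n) j) 0 = n) :
    ∃ f e, IsLinearization n k j f e ∧ Set.range e = affineOrbit k (geomSum k n) j := by
  have : NeZero (geomSum k n) := ⟨(geomSum_pos k (NeZero.pos n)).ne'⟩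
  let O : Finset (ZMod (geomSum k n)) :=
    (range n).image fun m => (affineMod k (geomSum k n) j)^[m] 0
  have hcard : #O = n := by
    have hinj := iterate_injOn_Iio_minimalPeriod (f := affineMod k (geomSum k n) j) (x := 0)
    rw [hper, ← coe_range] at hinj
    rw [card_image_of_injOn hinj, card_range]
  have hO (z : ZMod (geomSum k n)) : z ∈ O ↔ ∃ m, (affineMod k (geomSum k n) j)^[m] 0 = z := by
    simp only [O, mem_image, mem_range]
    refine ⟨fun ⟨m, _, hm⟩ => ⟨m, hm⟩, fun ⟨m, hm⟩ => ⟨m % n, Nat.mod_lt m (NeZero.pos n), ?_⟩⟩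
    rw [← hm, ← iterate_mod_minimalPeriod_eq (n := m), hper]
  obtain ⟨e, he, he_zero, he_add, hrange⟩ := exists_strictMono_range_eq_preimage ((hO 0).2 ⟨0, rfl⟩)
  rw [hcard] at he_add
  have hrange' : Set.range e = affineOrbit k (geomSum k n) j := Set.ext fun X =>
    (hrange X).trans (hO X)
  have hmaps (i : ℤ) : ∃ a, e a = k * e i + j := by
    obtain ⟨m, hm⟩ := (hO _).1 ((hrange _).1 ⟨i, rfl⟩)
    refine (hrange _).2 ((hO _).2 ⟨m + 1, ?_⟩)
    rw [iterate_succ_apply', hm, affineMod]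
    push_cast
    rfl
  choose f hf using hmaps
  exact ⟨f, e, ⟨he, he_zero, he_add, hf⟩, hrange'⟩

theorem IsLinearization.exists_isLift {f e : ℤ → ℤ} (he : IsLinearization n k j f e) (hk : 0 < k)
    (hj : j ∈ Set.Ico (0 : ℤ) (geomSum k n))
    (hrange : Set.range e = affineOrbit k (geomSum k n) j) :
    ∃ ν : Equiv.Perm (Fin n), ν.IsCycleOn Set.univ ∧ IsLift n k ν f := by
  have hadd (i : ℤ) : f (i + n) = f i + k * n := he.strictMono.injective <| by
    rw [mul_comm (k : ℤ), map_add_mul_of_map_add he.map_add, he.map_apply, he.map_add,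
      he.map_apply]
    ring
  have hmono : StrictMono f := fun a b hab => he.strictMono.lt_iff_lt.1 <| by
    rw [he.map_apply, he.map_apply]
    have := he.strictMono hab
    gcongr
  let g (x : Fin n) : Fin n := f (x : ℕ)
  have hg (i : ℤ) : g i = f i := by
    refine apply_val_intCast_fin_of_periodic (w := fun i => (f i : Fin n)) (fun i => ?_) i
    dsimp only
    rw [hadd, mul_comm, intCast_fin_eq_iff]
    exact ⟨k, rfl⟩
  have hiterate (m : ℕ) : g^[m] 0 = f^[m] 0 := by
    have hsemi : Semiconj (Int.cast : ℤ → Fin n) f g := fun i => (hg i).symm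
    rw [← Int.cast_zero, hsemi.iterate_right m 0]
  have hzero : 0 ∈ periodicPts g := by
    refine mk_mem_periodicPts (NeZero.pos n) ?_
    rw [IsPeriodicPt, IsFixedPt, hiterate, he.iterate_zero_eq_mul_iff.2 rfl]
    simp
  have hcover (y : Fin n) : ∃ m, g^[m] 0 = y := by
    obtain ⟨m, q, hq⟩ := mem_affineOrbit_iff.1 (hrange ▸ Set.mem_range_self ((y : ℕ) : ℤ))
    rw [← he.map_iterate_zero_add_mul] at hq
    refine ⟨m, ?_⟩
    rw [hiterate, ← intCast_val_fin y, eq_comm, intCast_fin_eq_iff]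
    exact ⟨q, he.strictMono.injective hq⟩
  obtain ⟨ν, hνg, hν⟩ := exists_perm_isCycleOn_univ hzero hcover
  exact ⟨ν, hν, hmono, hadd, he.offset_mem_Ico_iff.1 hj, fun i => by rw [hνg, hg]⟩

theorem exists_isLift_isLinearization_of_mem_primitiveOffsets (hn : 2 ≤ n)
    (hj : j ∈ primitiveOffsets k n) : ∃ (ν : Equiv.Perm (Fin n)) (f e : ℤ → ℤ),
      ν.IsCycleOn Set.univ ∧ IsLift n k ν f ∧ IsLinearization n k j f e := by
  obtain ⟨hmem, hper⟩ := mem_filter.1 hj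
  obtain ⟨f, e, he, hrange⟩ := exists_isLinearization_of_minimalPeriod_eq hper
  obtain ⟨ν, hν, hf⟩ :=
    he.exists_isLift (pos_of_mem_primitiveOffsets hn hj) (mem_Ico.1 hmem) hrange
  exact ⟨ν, f, e, hν, hf, he⟩

theorem IsLinearization.offset_unique {j' : ℤ} {f e e' : ℤ → ℤ} (he : IsLinearization n k j f e)
    (he' : IsLinearization n k j' f e') : j = j' := by
  have h := he.iterate_zero_eq_mul_iff.2 (rfl : geomSum k n * j = geomSum k n * j)
  have h' := he'.iterate_zero_eq_mul_iff.2 (rfl : geomSum k n * j' = geomSum k n * j')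
  exact Int.eq_of_mul_eq_mul_left (NeZero.ne _) (h.symm.trans h')

theorem card_lifts_nCycles (hn : 2 ≤ n) (k : ℕ) :
    Nat.card (Σ ν : {ν // ν ∈ nCycles n}, {f // IsLift n k ν f}) = #(primitiveOffsets k n) := by
  have : Nontrivial (Fin n) := Fin.nontrivial_iff_two_le.2 hn
  have hcycle (ν : {ν // ν ∈ nCycles n}) : ν.1.IsCycleOn Set.univ :=
    mem_nCycles_iff_isCycleOn.1 ν.2
  choose j e he using fun p : Σ ν : {ν // ν ∈ nCycles n}, {f // IsLift n k ν f} =>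
    p.2.2.exists_isLinearization (hcycle p.1)
  rw [← Nat.card_eq_finsetCard]
  refine Nat.card_eq_of_bijective
    (fun p => ⟨j p, p.2.2.offset_mem_primitiveOffsets (hcycle p.1) (he p)⟩) ⟨fun p p' h => ?_, ?_⟩
  · have he' := he p'
    rw [show j p' = j p from (congrArg Subtype.val h).symm] at he'
    obtain ⟨hν, hf⟩ :=
      p.2.2.eq_of_isLinearization (hcycle p.1) (he p) p'.2.2 (hcycle p'.1) he'
    obtain ⟨⟨ν, _⟩, f, _⟩ := p
    obtain ⟨⟨ν', _⟩, f', _⟩ := p'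
    obtain rfl : ν = ν' := hν
    obtain rfl : f = f' := hf
    rfl
  · rintro ⟨i, hi⟩
    obtain ⟨ν, f, e', hν, hf, he'⟩ := exists_isLift_isLinearization_of_mem_primitiveOffsets hn hi
    exact ⟨⟨⟨ν, mem_nCycles_iff_isCycleOn.2 hν⟩, f, hf⟩,
      Subtype.ext ((he _).offset_unique he')⟩

end Existence

section GeneratingFunction

open PowerSeries

theorem finite_sum_add_eq (ι : Type*) [Fintype ι] (d k : ℕ) :
    Finite {a : ι → ℕ // ∑ x, a x + d = k} := by
  classical
  refine ((piAntidiag univ (k - d)).finite_toSet).subset fun a (ha : ∑ x, a x + d = k) => ?_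
  rw [mem_coe, mem_piAntidiag]
  exact ⟨Nat.eq_sub_of_add_eq ha, fun i _ => mem_univ i⟩

theorem coeff_mk_one_pow_eq_card (R ι : Type*) [CommSemiring R] [Fintype ι] (t : ℕ) :
    coeff t (PowerSeries.mk 1 ^ Fintype.card ι : R⟦X⟧) = Nat.card {a : ι → ℕ // ∑ x, a x = t} := by
  classical
  have hcard : Nat.card {a : ι → ℕ // ∑ x, a x = t} = #(finsuppAntidiag (univ : Finset ι) t) := by
    rw [← Nat.subtype_card (p := fun a : ι →₀ ℕ => ∑ x, a x = t) _ fun a => by simp]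
    exact Nat.card_congr (Finsupp.equivFunOnFinite.symm.subtypeEquiv fun a => Iff.rfl)
  rw [← card_univ, ← prod_const, coeff_prod, hcard]
  simp

theorem coeff_X_pow_mul_mk_one_pow_eq_card (R ι : Type*) [CommSemiring R] [Fintype ι] (d k : ℕ) :
    coeff k (X ^ d * PowerSeries.mk 1 ^ Fintype.card ι : R⟦X⟧) =
      Nat.card {a : ι → ℕ // ∑ x, a x + d = k} := by
  rw [coeff_X_pow_mul']
  split_ifs with h
  · rw [coeff_mk_one_pow_eq_card]
    congr 1
    exact Nat.card_congr (Equiv.subtypeEquivRight fun a => by omega)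
  · have : IsEmpty {a : ι → ℕ // ∑ x, a x + d = k} := ⟨fun a => h (by have := a.2; omega)⟩
    rw [Nat.card_of_isEmpty, Nat.cast_zero]

theorem coeff_one_sub_X_pow (R : Type*) [CommRing R] (n m : ℕ) :
    coeff m ((1 - X : R⟦X⟧) ^ n) = (-1) ^ m * n.choose m := by
  have h : evalNegHom (((1 + Polynomial.X) ^ n : Polynomial R) : R⟦X⟧) = (1 - X) ^ n := by
    rw [Polynomial.coe_pow, map_pow, Polynomial.coe_add, map_add, Polynomial.coe_one, map_one,
      Polynomial.coe_X, evalNegHom_X, sub_eq_add_neg]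
  rw [← h, evalNegHom, coeff_rescale, Polynomial.coeff_coe, Polynomial.coeff_one_add_X_pow]

theorem mk_cycDelta_eq {n : ℕ} (hn : 2 ≤ n) :
    PowerSeries.mk (cycDelta n) = (∑ ν ∈ nCycles n, X ^ cycDeg ν) * PowerSeries.mk 1 ^ n := by
  have : NeZero n := ⟨by omega⟩
  have : Nontrivial (Fin n) := Fin.nontrivial_iff_two_le.2 hn
  ext k
  have hfinite (ν : Equiv.Perm (Fin n)) : Finite {f // IsLift n k ν f} :=
    have := finite_sum_add_eq (Fin n) (cycDeg ν) k
    Finite.of_equiv _ (liftEquivExcess k ν).symm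
  have hcard (ν : Equiv.Perm (Fin n)) :
      coeff k (X ^ cycDeg ν * PowerSeries.mk 1 ^ n : ℤ⟦X⟧) = Nat.card {f // IsLift n k ν f} := by
    have h := coeff_X_pow_mul_mk_one_pow_eq_card ℤ (Fin n) (cycDeg ν) k
    rwa [Fintype.card_fin, ← Nat.card_congr (liftEquivExcess k ν)] at h
  rw [coeff_mk, cycDelta_eq_card_primitiveOffsets k (NeZero.pos n), ← card_lifts_nCycles hn,
    Nat.card_sigma, Nat.cast_sum, sum_mul, map_sum,
    sum_coe_sort (nCycles n) fun ν => (Nat.card {f // IsLift n k ν f} : ℤ)]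
  exact sum_congr rfl fun ν _ => (hcard ν).symm

theorem cycDelta_zero_right {n : ℕ} (hn : 2 ≤ n) : cycDelta n 0 = 0 := by
  have hempty : primitiveOffsets 0 n = ∅ := eq_empty_of_forall_notMem fun _ hj =>
    (pos_of_mem_primitiveOffsets hn hj).false
  rw [cycDelta_eq_card_primitiveOffsets 0 (by omega), hempty, card_empty, Nat.cast_zero]

theorem numCyclesOfDeg_eq_sum {n : ℕ} (hn : 2 ≤ n) (d : ℕ) : (numCyclesOfDeg n d : ℤ) =
    ∑ i ∈ Icc 1 d, (-1 : ℤ) ^ (d - i) * (n.choose (d - i) : ℤ) * cycDelta n i := by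
  have hgen : PowerSeries.mk (cycDelta n) * (1 - X) ^ n =
      ∑ ν ∈ nCycles n, (X : ℤ⟦X⟧) ^ cycDeg ν := by
    rw [mk_cycDelta_eq hn, mul_assoc, ← mul_pow, mk_one_mul_one_sub_eq_one, one_pow, mul_one]
  calc (numCyclesOfDeg n d : ℤ) = coeff d (∑ ν ∈ nCycles n, (X : ℤ⟦X⟧) ^ cycDeg ν) := by
        simp only [numCyclesOfDeg, natCast_card_filter, map_sum, coeff_X_pow, eq_comm (a := d)]
    _ = ∑ i ∈ range (d + 1), cycDelta n i * ((-1) ^ (d - i) * n.choose (d - i)) := by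
        rw [← hgen, coeff_mul, Nat.sum_antidiagonal_eq_sum_range_succ_mk]
        simp only [coeff_mk, coeff_one_sub_X_pow]
    _ = ∑ i ∈ Icc 1 d, (-1 : ℤ) ^ (d - i) * (n.choose (d - i) : ℤ) * cycDelta n i := by
        rw [range_eq_Ico, sum_eq_sum_Ico_succ_bot (Nat.succ_pos d), cycDelta_zero_right hn,
          zero_mul, zero_add]
        exact sum_congr (by ext; simp) fun i _ => mul_comm _ _

end GeneratingFunction

section Vanishing

theorem cycDeg_add_cycDeg_trans_revPerm {n : ℕ} (hn : 2 ≤ n) (ν : Equiv.Perm (Fin n)) :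
    cycDeg ν + cycDeg (ν.trans Fin.revPerm) = n := by
  have : NeZero n := ⟨by omega⟩
  have hne (x : Fin n) : ν (finRotate n x) ≠ ν x := by
    rw [ν.injective.ne_iff, finRotate_apply, ne_eq, add_eq_left, Fin.one_eq_zero_iff]
    omega
  have hrev : cycDeg (ν.trans Fin.revPerm) = #{x | ¬ν (finRotate n x) < ν x} := by
    simp only [cycDeg, Equiv.trans_apply, Fin.revPerm_apply, Fin.rev_lt_rev, not_lt,
      (hne _).symm.le_iff_lt]
  rw [hrev, cycDeg, card_filter_add_card_filter_not, card_univ, Fintype.card_fin]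

theorem IsLift.eq_add_of_degree_one {n : ℕ} [NeZero n] {ν : Equiv.Perm (Fin n)} {f : ℤ → ℤ}
    (hf : IsLift n 1 ν f) (i : ℤ) : f i = i + f 0 := by
  have hmono : Monotone fun i => f i - i := monotone_int_of_le_succ fun i => by
    have := hf.strictMono (lt_add_one i)
    omega
  have hper : Periodic (fun i => f i - i) n := fun i => by
    have := hf.map_add i
    push_cast at this
    linarith
  linarith [eq_of_monotone_of_periodic hmono hper (Int.natCast_pos.2 (NeZero.pos n)) i 0]

open scoped Fin.CommRing in
theorem exists_eq_add_of_cycDeg_le_one {n : ℕ} [NeZero n] [Nontrivial (Fin n)]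
    {ν : Equiv.Perm (Fin n)} (hν : cycDeg ν ≤ 1) : ∃ c, ∀ x, ν x = x + c := by
  obtain ⟨f, hf, -⟩ := exists_isLift_of_sum_add_cycDeg_eq ν (Pi.single 0 (1 - cycDeg ν))
    (by rw [sum_pi_single', if_pos (mem_univ _), Nat.sub_add_cancel hν])
  refine ⟨f 0, fun x => ?_⟩
  rw [← intCast_val_fin x, ← hf.cast_map, hf.eq_add_of_degree_one, Int.cast_add]

open scoped Fin.CommRing in
theorem cycDeg_lt_of_mem_nCycles {n : ℕ} (hn : 3 ≤ n) {ν : Equiv.Perm (Fin n)}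
    (hν : ν ∈ nCycles n) : cycDeg ν < n - 1 := by
  have : NeZero n := ⟨by omega⟩
  have : Nontrivial (Fin n) := Fin.nontrivial_iff_two_le.2 (by omega)
  by_contra! hdeg
  have hsum := cycDeg_add_cycDeg_trans_revPerm (by omega) ν
  obtain ⟨c, hc⟩ := exists_eq_add_of_cycDeg_le_one (ν := ν.trans Fin.revPerm) (by omega)
  have hreflection (x : Fin n) : ν x = (x + c).rev := Fin.rev_eq_iff.1 (hc x)
  have hinvolution : (ν ^ 2) 0 = 0 := by
    rw [pow_two, Equiv.Perm.mul_apply, hreflection, hreflection, Fin.rev_add, Fin.rev_rev,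
      add_sub_cancel_right]
  have hcycle := mem_nCycles_iff_isCycleOn.1 hν
  rw [← coe_univ] at hcycle
  have hdvd := (hcycle.pow_apply_eq (mem_univ 0)).1 hinvolution
  rw [card_univ, Fintype.card_fin] at hdvd
  exact absurd (Nat.le_of_dvd two_pos hdvd) (by omega)

theorem numCyclesOfDeg_eq_zero {n d : ℕ} (hn : 3 ≤ n) (hd : n - 1 ≤ d) :
    numCyclesOfDeg n d = 0 := by
  rw [numCyclesOfDeg, card_eq_zero, filter_eq_empty_iff]
  rintro ν hν rfl
  exact (cycDeg_lt_of_mem_nCycles hn hν).not_ge hd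

end Vanishing

theorem mainTheorem1 (n : ℕ) (hn : 2 ≤ n) :
    (∀ d : ℕ, 1 ≤ d →
      (numCyclesOfDeg n d : ℤ) =
        ∑ i ∈ Finset.Icc 1 d, (-1 : ℤ) ^ (d - i) * (n.choose (d - i) : ℤ) * cycDelta n i) ∧
    (3 ≤ n → ∀ d : ℕ, n - 1 ≤ d →
      ∑ i ∈ Finset.Icc 1 d, (-1 : ℤ) ^ (d - i) * (n.choose (d - i) : ℤ) * cycDelta n i = 0) := by
  refine ⟨fun d _ => numCyclesOfDeg_eq_sum hn d, fun hn3 d hd => ?_⟩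
  rw [← numCyclesOfDeg_eq_sum hn, numCyclesOfDeg_eq_zero hn3 hd, Nat.cast_zero]
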